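/- All rings are associative with $1$. Let $R$ be a ring. A right $R$-module $M$ is called $R$-projective (respectively, max-projective) if for every right ideal (respectively, every maximal right ideal) $I$ of $R$, each homomorphism $M\to R/I$ factors through the canonical projection $R\to R/I$. The ring $R$ is called right almost-QF (respectively, right max-QF) if every injective right $R$-module is $R$-projective (respectively, max-projective), and QF (quasi-Frobenius) if it is right self-injective and right Artinian. Let $k$ be a field, let $R=k[x,y]/(x^2,y^2)$, let $I=(x^2,xy,y^2)/(x^2,y^2)$, an ideal of $R$, and let $S=R/I$. Then: (1) $R$ is a local QF ring; moreover $R$ is right almost-QF and right max-QF. (2) $S\cong k[x,y]/(x^2,xy,y^2)$ as $k$-algebras; $S$ is right Artinian, but it is not right self-injective, hence not QF; moreover $S$ is neither right max-QF nor right almost-QF. (3) Consequently neither the class of right max-QF rings nor the class of right almost-QF rings is closed under factor rings by two-sided ideals. (As $R$ and $S$ are commutative, "right" may be dropped in (1) and (2).) -/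

import Mathlib

universe u v w

namespace MaxQF

/-! Right modules over a ring `R` are modules over `Rᵐᵒᵖ`; in particular right ideals of `R` are
the terms of `Submodule Rᵐᵒᵖ R`, and for such an `I` the right module `R / I` is `R ⧸ I`, with
canonical projection `I.mkQ`. -/

/-- A right `R`-module `M` is `R`-projective if every homomorphism `M → R / I`, with `I` a right
ideal, factors through the canonical projection `R → R / I`. -/
def IsRProjective (R : Type u) [Ring R] (M : Type v) [AddCommGroup M] [Module Rᵐᵒᵖ M] : Prop :=
  ∀ (I : Submodule Rᵐᵒᵖ R) (f : M →ₗ[Rᵐᵒᵖ] R ⧸ I), ∃ g : M →ₗ[Rᵐᵒᵖ] R, I.mkQ ∘ₗ g = f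

/-- A right `R`-module `M` is max-projective if every homomorphism `M → R / I`, with `I` a maximal
right ideal, factors through the canonical projection `R → R / I`. -/
def IsMaxProjective (R : Type u) [Ring R] (M : Type v) [AddCommGroup M] [Module Rᵐᵒᵖ M] : Prop :=
  ∀ I : Submodule Rᵐᵒᵖ R, IsCoatom I →
    ∀ f : M →ₗ[Rᵐᵒᵖ] R ⧸ I, ∃ g : M →ₗ[Rᵐᵒᵖ] R, I.mkQ ∘ₗ g = f

/-- `R` is right almost-QF if every injective right `R`-module is `R`-projective. The modules range
over an arbitrary universe at least as large as that of `R`. -/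
def IsRightAlmostQF (R : Type u) [Ring R] : Prop :=
  ∀ (E : Type (max u w)) [AddCommGroup E] [Module Rᵐᵒᵖ E],
    Module.Injective Rᵐᵒᵖ E → IsRProjective R E

/-- `R` is right max-QF if every injective right `R`-module is max-projective. The modules range
over an arbitrary universe at least as large as that of `R`. -/
def IsRightMaxQF (R : Type u) [Ring R] : Prop :=
  ∀ (E : Type (max u w)) [AddCommGroup E] [Module Rᵐᵒᵖ E],
    Module.Injective Rᵐᵒᵖ E → IsMaxProjective R E

/-- `R` is right self-injective: the right module `R` is injective. -/
def IsRightSelfInjective (R : Type u) [Ring R] : Prop :=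
  Module.Injective Rᵐᵒᵖ R

/-- `R` is right Artinian: descending chain condition on right ideals. -/
def IsRightArtinian (R : Type u) [Ring R] : Prop :=
  IsArtinian Rᵐᵒᵖ R

/-- `R` is quasi-Frobenius: right self-injective and right Artinian. -/
def IsQF (R : Type u) [Ring R] : Prop :=
  IsRightSelfInjective R ∧ IsRightArtinian R

/-- The ideal `(x², y²)` of `k[x, y]`. -/
noncomputable abbrev idealSq (k : Type u) [Field k] : Ideal (MvPolynomial (Fin 2) k) :=
  Ideal.span {MvPolynomial.X 0 ^ 2, MvPolynomial.X 1 ^ 2}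

/-- The ideal `(x², xy, y²)` of `k[x, y]`. -/
noncomputable abbrev idealSqMul (k : Type u) [Field k] : Ideal (MvPolynomial (Fin 2) k) :=
  Ideal.span {MvPolynomial.X 0 ^ 2, MvPolynomial.X 0 * MvPolynomial.X 1, MvPolynomial.X 1 ^ 2}

/-- The ring `R = k[x, y] / (x², y²)`. -/
noncomputable abbrev RingR (k : Type u) [Field k] : Type u :=
  MvPolynomial (Fin 2) k ⧸ idealSq k

/-- The ideal `I = (x², xy, y²) / (x², y²)` of `R`. -/
noncomputable abbrev idealI (k : Type u) [Field k] : Ideal (RingR k) :=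
  (idealSqMul k).map (Ideal.Quotient.mk (idealSq k))

/-- The factor ring `S = R / I`. -/
noncomputable abbrev RingS (k : Type u) [Field k] : Type u :=
  RingR k ⧸ idealI k

end MaxQF

namespace MaxQF

/-! `R` has basis `1, x, y, xy` and simple socle `k·xy`. A functional nonzero on `xy` therefore
identifies `R` with its `k`-dual, which is always injective, so `R` is self-injective. Moreover
every injective `R`-module is free (`free_of_baer`), hence projective, and so maps out of it lift
through every `R → R/J`.

In `S` all products of `x` and `y` vanish and the socle `kx + ky` is two-dimensional. The map `y ↦
x` between socle lines is not a multiplication, so `S` is not self-injective; and `φ ↦ φ x`, from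
the injective dual of `S` to the residue field, does not lift to `S` (`not_exists_lift`). Both
failures pass through annihilators of `y`. -/

/-- The `k`-linear dual of a commutative `k`-algebra `A`, as an `A`-module. -/
def DualModule (k : Type u) (A : Type v) [Field k] [CommRing A] [Algebra k A] : Type (max u v) :=
  A →ₗ[k] k

/-! ### Injectivity of the dual module -/

namespace DualModule

variable {k : Type u} {A : Type v} [Field k] [CommRing A] [Algebra k A]

noncomputable instance : AddCommGroup (DualModule k A) :=
  inferInstanceAs (AddCommGroup (A →ₗ[k] k))

/-- The functional underlying an element of the dual. -/
def toLin (φ : DualModule k A) : A →ₗ[k] k := φ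

@[ext] theorem ext {φ ψ : DualModule k A} (h : ∀ a, φ.toLin a = ψ.toLin a) : φ = ψ :=
  LinearMap.ext h

noncomputable instance : Module A (DualModule k A) where
  smul a φ := φ.toLin ∘ₗ LinearMap.mulLeft k a
  one_smul φ := ext fun r => congrArg φ.toLin (one_mul r)
  mul_smul a b φ := ext fun r => congrArg φ.toLin (by
    change (a * b) * r = b * (a * r)
    ring)
  smul_zero _ := rfl
  smul_add _ _ _ := rfl
  add_smul a b φ := ext fun r => (congrArg φ.toLin (add_mul a b r)).trans (map_add φ.toLin _ _)
  zero_smul φ := ext fun r => (congrArg φ.toLin (zero_mul r)).trans (map_zero φ.toLin)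

theorem smul_toLin (a : A) (φ : DualModule k A) (r : A) : (a • φ).toLin r = φ.toLin (a * r) := rfl

theorem add_toLin (φ ψ : DualModule k A) (r : A) : (φ + ψ).toLin r = φ.toLin r + ψ.toLin r := rfl

/-- An `A`-map `g : I → A*` is determined by the functional `i ↦ g i 1`, and functionals extend from
`I` to `A` because `k` is a field. -/
theorem baer : Module.Baer A (DualModule k A) := by
  intro I g
  let μ₀ : I.restrictScalars k →ₗ[k] k :=
    { toFun := fun i => (g i).toLin 1
      map_add' := fun i j => by
        rw [show g (i + j) = g i + g j from map_add g (i : I) (j : I)]; rfl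
      map_smul' := fun c i => by
        let j : I := i
        have h : (c • i : I.restrictScalars k) = (algebraMap k A c • j : I) :=
          Subtype.ext (algebra_compatible_smul A c (i : A))
        have h2 : g (c • i : I.restrictScalars k) = algebraMap k A c • g j :=
          (congrArg g h).trans (map_smul g _ j)
        refine (congrArg (fun φ => toLin φ 1) h2).trans ?_
        rw [smul_toLin, ← Algebra.smul_def, map_smul]
        rfl }
  obtain ⟨μ, hμ⟩ := μ₀.exists_extend
  refine ⟨LinearMap.toSpanSingleton A _ (μ : DualModule k A), fun i hi => ext fun r => ?_⟩
  have h := LinearMap.congr_fun hμ ⟨i * r, I.mul_mem_right r hi⟩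
  have h2 : g ⟨i * r, I.mul_mem_right r hi⟩ = r • g ⟨i, hi⟩ := by
    rw [← map_smul]; congr 1; exact Subtype.ext (mul_comm i r)
  change μ (i * r) = _
  refine h.trans ?_
  change (g ⟨i * r, _⟩).toLin 1 = _
  rw [h2, smul_toLin, mul_one]

end DualModule

/-! ### The algebra with basis `1, x, y, xy` -/

/-- `x` and `y` generate the `k`-algebra `A` subject to the relations `x² = y² = 0` and
`x * y ≠ 0`. -/
structure IsSquareZeroPair (k : Type u) {A : Type v} [Field k] [CommRing A] [Algebra k A]
    (x y : A) : Prop where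
  x_mul_x : x * x = 0
  y_mul_y : y * y = 0
  x_mul_y_ne : x * y ≠ 0
  exists_eq (r : A) : ∃ a b c d : k,
    r = algebraMap k A a + b • x + c • y + d • (x * y)

namespace IsSquareZeroPair

variable {k : Type u} {A : Type v} [Field k] [CommRing A] [Algebra k A] {x y : A}

theorem mul_x (h : IsSquareZeroPair k x y) (a b c d : k) :
    (algebraMap k A a + b • x + c • y + d • (x * y)) * x = a • x + c • (x * y) := by
  simp only [Algebra.smul_def]
  linear_combination (algebraMap k A b + algebraMap k A d * y) * h.x_mul_x

theorem mul_y (h : IsSquareZeroPair k x y) (a b c d : k) :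
    (algebraMap k A a + b • x + c • y + d • (x * y)) * y = a • y + b • (x * y) := by
  simp only [Algebra.smul_def]
  linear_combination (algebraMap k A c + algebraMap k A d * x) * h.y_mul_y

/-- The socle is the line `k·xy`: comparing coefficients in `rx = 0` and `ry = 0` leaves only the
last one. -/
theorem exists_eq_smul (h : IsSquareZeroPair k x y) {r : A} (hx : r * x = 0) (hy : r * y = 0) :
    ∃ d : k, r = d • (x * y) := by
  obtain ⟨a, b, c, d, rfl⟩ := h.exists_eq r
  rw [h.mul_x] at hx
  rw [h.mul_y] at hy
  have ha : a = 0 := by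
    have : a • (x * y) = 0 := by
      simp only [Algebra.smul_def] at hx ⊢
      linear_combination y * hx - algebraMap k A c * x * h.y_mul_y
    exact (smul_eq_zero.mp this).resolve_right h.x_mul_y_ne
  subst ha
  rw [zero_smul, zero_add] at hx hy
  have hb := (smul_eq_zero.mp hy).resolve_right h.x_mul_y_ne
  have hc := (smul_eq_zero.mp hx).resolve_right h.x_mul_y_ne
  exact ⟨d, by simp [hb, hc]⟩

theorem finite (h : IsSquareZeroPair k x y) : Module.Finite k A := by
  classical
  refine ⟨⟨{1, x, y, x * y}, eq_top_iff.mpr fun r _ => ?_⟩⟩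
  obtain ⟨a, b, c, d, rfl⟩ := h.exists_eq r
  rw [Algebra.algebraMap_eq_smul_one]
  have hs {z : A} (hz : z ∈ ({1, x, y, x * y} : Finset A)) :
      z ∈ Submodule.span k (({1, x, y, x * y} : Finset A) : Set A) := Submodule.subset_span hz
  exact add_mem (add_mem (add_mem (Submodule.smul_mem _ _ (hs (by simp)))
    (Submodule.smul_mem _ _ (hs (by simp)))) (Submodule.smul_mem _ _ (hs (by simp))))
    (Submodule.smul_mem _ _ (hs (by simp)))

theorem isLocalRing (h : IsSquareZeroPair k x y) : IsLocalRing A := by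
  have : Nontrivial A := ⟨⟨_, _, h.x_mul_y_ne⟩⟩
  have key (a b c d : k) (ha : a ≠ 0) :
      IsUnit (algebraMap k A a + b • x + c • y + d • (x * y)) := by
    have hx : IsNilpotent x := ⟨2, by rw [sq, h.x_mul_x]⟩
    have hy : IsNilpotent y := ⟨2, by rw [sq, h.y_mul_y]⟩
    have hn : IsNilpotent (b • x + c • y + d • (x * y)) := by
      simp only [Algebra.smul_def, ← mem_nilradical] at *
      exact add_mem (add_mem (Ideal.mul_mem_left _ _ hx) (Ideal.mul_mem_left _ _ hy))
        (Ideal.mul_mem_left _ _ (Ideal.mul_mem_left _ _ hy))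
    have := hn.isUnit_add_left_of_commute ((isUnit_iff_ne_zero.mpr ha).map (algebraMap k A))
      (Commute.all _ _)
    simpa only [add_assoc] using this
  refine IsLocalRing.of_isUnit_or_isUnit_one_sub_self fun r => ?_
  obtain ⟨a, b, c, d, rfl⟩ := h.exists_eq r
  by_cases ha : a = 0
  · right
    have := key 1 (-b) (-c) (-d) one_ne_zero
    convert this using 1
    simp only [ha, map_zero, map_one, neg_smul]
    ring
  · exact Or.inl (key a b c d ha)

/-- Every nonzero ideal meets the socle: multiply `r` by `x` or `y` for as long as the product stays
nonzero. -/
theorem exists_mul_eq (h : IsSquareZeroPair k x y) {r : A} (hr : r ≠ 0) :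
    ∃ s d, d ≠ 0 ∧ s * r = algebraMap k A d * (x * y) := by
  by_cases hx : r * x = 0
  · by_cases hy : r * y = 0
    · obtain ⟨d, rfl⟩ := h.exists_eq_smul hx hy
      exact ⟨1, d, fun hd => hr (by rw [hd, zero_smul]), by rw [one_mul, Algebra.smul_def]⟩
    · obtain ⟨d, hd⟩ := h.exists_eq_smul (r := r * y) (by rw [mul_right_comm, hx, zero_mul])
        (by rw [mul_assoc, h.y_mul_y, mul_zero])
      exact ⟨y, d, fun h0 => hy (by rw [hd, h0, zero_smul]),
        by rw [mul_comm, hd, Algebra.smul_def]⟩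
  · by_cases hy : r * x * y = 0
    · obtain ⟨d, hd⟩ := h.exists_eq_smul (r := r * x)
        (by rw [mul_assoc, h.x_mul_x, mul_zero]) hy
      exact ⟨x, d, fun h0 => hx (by rw [hd, h0, zero_smul]),
        by rw [mul_comm, hd, Algebra.smul_def]⟩
    · obtain ⟨d, hd⟩ := h.exists_eq_smul (r := r * x * y)
        (by rw [mul_right_comm, mul_assoc r x x, h.x_mul_x, mul_zero, zero_mul])
        (by rw [mul_assoc, h.y_mul_y, mul_zero])
      exact ⟨x * y, d, fun h0 => hy (by rw [hd, h0, zero_smul]),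
        by rw [mul_comm, ← mul_assoc, hd, Algebra.smul_def]⟩

theorem exists_functional (h : IsSquareZeroPair k x y) : ∃ l : A →ₗ[k] k, l (x * y) = 1 := by
  obtain ⟨f, hf, -⟩ := Submodule.exists_le_ker_of_notMem (p := (⊥ : Submodule k A))
    (v := x * y) h.x_mul_y_ne
  exact ⟨(f (x * y))⁻¹ • f, inv_mul_cancel₀ hf⟩

/-- The pairing `(a, b) ↦ l (ab)` is nondegenerate because nonzero ideals contain `xy`; by
dimension, `A` is isomorphic to its dual. -/
theorem baer (h : IsSquareZeroPair k x y) : Module.Baer A A := by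
  have := h.finite
  obtain ⟨l, hl⟩ := h.exists_functional
  let F : A →ₗ[A] DualModule k A := LinearMap.toSpanSingleton A _ (l : DualModule k A)
  let G : A →ₗ[k] Module.Dual k A :=
    { toFun := fun a => F a
      map_add' := fun a b => map_add F a b
      map_smul' := fun c a => LinearMap.ext fun r => by
        change l ((c • a) * r) = c • l (a * r)
        rw [smul_mul_assoc, map_smul] }
  have hF : Function.Injective F := by
    refine (injective_iff_map_eq_zero F).mpr fun r hr => ?_
    by_contra hr0
    obtain ⟨s, d, hd, hs⟩ := h.exists_mul_eq hr0
    have h1 : l (r * s) = 0 := LinearMap.congr_fun hr s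
    rw [mul_comm, hs, ← Algebra.smul_def, map_smul, hl, smul_eq_mul, mul_one] at h1
    exact hd h1
  have hG : Function.Surjective G :=
    (LinearMap.injective_iff_surjective_of_finrank_eq_finrank
      Subspace.dual_finrank_eq.symm).mp (show Function.Injective G from hF)
  exact DualModule.baer.of_equiv (LinearEquiv.ofBijective F ⟨hF, hG⟩).symm

end IsSquareZeroPair
end MaxQF

/-! ### Injective modules over this algebra are free -/

namespace MaxQF
namespace IsSquareZeroPair

variable {k : Type u} {A : Type v} [Field k] [CommRing A] [Algebra k A] {x y : A}

/-- In an injective module, an element killed by `x * y` lies in `x E + y E`. -/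
theorem exists_eq_add_of_smul_eq_zero (h : IsSquareZeroPair k x y) {E : Type w} [AddCommGroup E]
    [Module A E] (hE : Module.Baer A E) {e : E} (he : (x * y) • e = 0) :
    ∃ a b : E, e = x • a + y • b := by
  -- The kernel of `r ↦ (rx, ry)` is the socle, which kills `e`; so `(x, y) ↦ e` is well defined and
  -- extends to `A × A`.
  let φ : A →ₗ[A] A × A := LinearMap.toSpanSingleton A (A × A) (x, y)
  have hle : LinearMap.ker φ ≤ LinearMap.ker (LinearMap.toSpanSingleton A E e) := by
    intro r hr
    have hr' : (r * x, r * y) = ((0, 0) : A × A) := hr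
    obtain ⟨d, rfl⟩ := h.exists_eq_smul (congrArg Prod.fst hr') (congrArg Prod.snd hr')
    rw [LinearMap.mem_ker, LinearMap.toSpanSingleton_apply, Algebra.smul_def, mul_smul, he,
      smul_zero]
  obtain ⟨g, hg⟩ := hE.extension_property ((LinearMap.ker φ).liftQ φ le_rfl)
    (LinearMap.ker_eq_bot.mp (Submodule.ker_liftQ_eq_bot _ _ _ le_rfl))
    ((LinearMap.ker φ).liftQ _ hle)
  have h1 : g ((1 : A) • (x, y)) = (1 : A) • e :=
    LinearMap.congr_fun hg ((LinearMap.ker φ).mkQ 1)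
  refine ⟨g (1, 0), g (0, 1), ?_⟩
  rw [one_smul, one_smul] at h1
  rw [← h1, ← map_smul, ← map_smul, ← map_add]
  simp

/-- A `k`-basis of a complement `C` of `xE + yE` is an `A`-basis of `E`. Spanning is Nakayama for a
nilpotent ideal; independence is tested on the socle, where injectivity of `E` enters. -/
theorem free_of_baer_of_isScalarTower (h : IsSquareZeroPair k x y) {E : Type w} [AddCommGroup E]
    [Module A E] [Module k E] [IsScalarTower k A E] (hE : Module.Baer A E) : Module.Free A E := by
  have hxx (e : E) : x • x • e = 0 := by rw [smul_smul, h.x_mul_x, zero_smul]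
  have hyy (e : E) : y • y • e = 0 := by rw [smul_smul, h.y_mul_y, zero_smul]
  have hyx (e : E) : y • x • e = x • y • e := smul_comm _ _ _
  let U : Submodule k E :=
    LinearMap.range (DistribSMul.toLinearMap k E x) ⊔ LinearMap.range (DistribSMul.toLinearMap k E y)
  have hU (e : E) : e ∈ U ↔ ∃ a b : E, e = x • a + y • b := by
    simp only [U, Submodule.mem_sup, LinearMap.mem_range]
    constructor
    · rintro ⟨_, ⟨a, rfl⟩, _, ⟨b, rfl⟩, rfl⟩
      exact ⟨a, b, rfl⟩
    · rintro ⟨a, b, rfl⟩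
      exact ⟨_, ⟨a, rfl⟩, _, ⟨b, rfl⟩, rfl⟩
  obtain ⟨C, hC⟩ := U.exists_isCompl
  let β := Module.Basis.ofVectorSpace k C
  let F := Finsupp.linearCombination A (fun i => (β i : E))
  have hCF (c : E) (hc : c ∈ C) : c ∈ LinearMap.range F := by
    have h1 : ⊤ ≤ ((LinearMap.range F).restrictScalars k).comap C.subtype := by
      rw [← β.span_eq, Submodule.span_le]
      rintro _ ⟨i, rfl⟩
      exact ⟨Finsupp.single i 1, by simp [F]⟩
    exact h1 (x := ⟨c, hc⟩) trivial
  have hdec (e : E) : ∃ n ∈ LinearMap.range F, ∃ a b : E, e = n + x • a + y • b := by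
    have : e ∈ U ⊔ C := by rw [hC.sup_eq_top]; trivial
    obtain ⟨u, hu, c, hc, rfl⟩ := Submodule.mem_sup.mp this
    obtain ⟨a, b, rfl⟩ := (hU u).mp hu
    exact ⟨c, hCF c hc, a, b, by abel⟩
  have hsurj : Function.Surjective F := by
    -- Nakayama by hand: first `xyE`, then `xE` and `yE`, then `E`.
    have h2 (e : E) : x • y • e ∈ LinearMap.range F := by
      obtain ⟨n, hn, a, b, rfl⟩ := hdec e
      simp only [smul_add, hyy, hyx, hxx, add_zero]
      exact Submodule.smul_mem _ _ (Submodule.smul_mem _ _ hn)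
    have hx (e : E) : x • e ∈ LinearMap.range F := by
      obtain ⟨n, hn, a, b, rfl⟩ := hdec e
      simp only [smul_add, hxx, add_zero]
      exact add_mem (Submodule.smul_mem _ _ hn) (h2 b)
    have hy (e : E) : y • e ∈ LinearMap.range F := by
      obtain ⟨n, hn, a, b, rfl⟩ := hdec e
      simp only [smul_add, hyy, add_zero, hyx]
      exact add_mem (Submodule.smul_mem _ _ hn) (h2 a)
    intro e
    obtain ⟨n, hn, a, b, rfl⟩ := hdec e
    exact add_mem (add_mem hn (hx a)) (hy b)
  obtain ⟨l, hl⟩ := h.exists_functional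
  have hsoc (p) (hp : F p = 0) (hpx : x • p = 0) (hpy : y • p = 0) : p = 0 := by
    let γ := p.mapRange l (map_zero l)
    have hγ (i) : p i = γ i • (x * y) := by
      obtain ⟨d, hd⟩ := h.exists_eq_smul (r := p i)
        (by rw [mul_comm]; exact DFunLike.congr_fun hpx i)
        (by rw [mul_comm]; exact DFunLike.congr_fun hpy i)
      rw [Finsupp.mapRange_apply, hd, map_smul, hl, smul_eq_mul, mul_one]
    have hp' : p = Finsupp.mapRange (fun c : k => c • (x * y)) (zero_smul _ _) γ :=
      Finsupp.ext hγ
    -- A socle element of the kernel is `xy` times a vector of `C`. Being killed by `xy`, that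
    -- vector lies in `xE + yE`, hence in `(xE + yE) ∩ C = 0`.
    have h3 : (x * y) • ((Finsupp.linearCombination k β γ : C) : E) = 0 := by
      rw [← hp, hp', Finsupp.linearCombination_apply, Finsupp.linearCombination_apply,
        Finsupp.sum_mapRange_index (h := fun i a => a • (β i : E)) (fun _ => zero_smul _ _), Finsupp.sum, Finsupp.sum,
        AddSubmonoidClass.coe_finsetSum, Finset.smul_sum]
      refine Finset.sum_congr rfl fun i _ => ?_
      rw [Submodule.coe_smul, smul_assoc, smul_comm]
    have h4 : ((Finsupp.linearCombination k β γ : C) : E) = 0 :=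
      Submodule.disjoint_def.mp hC.disjoint _
        ((hU _).mpr (h.exists_eq_add_of_smul_eq_zero hE h3)) (Subtype.coe_prop _)
    have h5 : γ = 0 := linearIndependent_iff.mp β.linearIndependent γ (Subtype.ext h4)
    ext i
    rw [hγ, h5, Finsupp.zero_apply, zero_smul, Finsupp.zero_apply]
  have hpx (p) (hp : F p = 0) (hpx : x • p = 0) : p = 0 := by
    refine hsoc p hp hpx (hsoc _ (by rw [map_smul, hp, smul_zero]) ?_ ?_)
    · rw [smul_comm, hpx, smul_zero]
    · rw [smul_smul, h.y_mul_y, zero_smul]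
  have hinj : Function.Injective F := by
    refine (injective_iff_map_eq_zero F).mpr fun p hp => ?_
    refine hpx p hp (hpx _ (by rw [map_smul, hp, smul_zero]) ?_)
    rw [smul_smul, h.x_mul_x, zero_smul]
  exact Module.Free.of_equiv (LinearEquiv.ofBijective F ⟨hinj, hsurj⟩)

theorem free_of_baer (h : IsSquareZeroPair k x y) {E : Type w} [AddCommGroup E]
    [Module A E] (hE : Module.Baer A E) : Module.Free A E := by
  let : Module k E := Module.compHom E (algebraMap k A)
  have : IsScalarTower k A E := ⟨fun c a e => by
    rw [Algebra.smul_def, mul_smul]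
    rfl⟩
  exact h.free_of_baer_of_isScalarTower hE

end IsSquareZeroPair

/-! ### The algebra with basis `1, x, y` -/

/-- `x` and `y` generate the `k`-algebra `A` subject to the relations `x² = x * y = y² = 0`, and
are linearly independent over `k`. -/
structure IsProductZeroPair (k : Type u) {A : Type v} [Field k] [CommRing A] [Algebra k A]
    (x y : A) : Prop where
  x_mul_x : x * x = 0
  x_mul_y : x * y = 0
  y_mul_y : y * y = 0
  y_ne : y ≠ 0
  x_ne (c : k) : x ≠ c • y
  exists_eq (r : A) : ∃ a b c : k, r = algebraMap k A a + b • x + c • y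

namespace IsProductZeroPair

variable {k : Type u} {A : Type v} [Field k] [CommRing A] [Algebra k A] {x y : A}

theorem mul_x (h : IsProductZeroPair k x y) (a b c : k) :
    (algebraMap k A a + b • x + c • y) * x = a • x := by
  simp only [Algebra.smul_def]
  linear_combination algebraMap k A b * h.x_mul_x + algebraMap k A c * h.x_mul_y

theorem mul_y (h : IsProductZeroPair k x y) (a b c : k) :
    (algebraMap k A a + b • x + c • y) * y = a • y := by
  simp only [Algebra.smul_def]
  linear_combination algebraMap k A b * h.x_mul_y + algebraMap k A c * h.y_mul_y

theorem finite (h : IsProductZeroPair k x y) : Module.Finite k A := by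
  classical
  refine ⟨⟨{1, x, y}, eq_top_iff.mpr fun r _ => ?_⟩⟩
  obtain ⟨a, b, c, rfl⟩ := h.exists_eq r
  rw [Algebra.algebraMap_eq_smul_one]
  have hs {z : A} (hz : z ∈ ({1, x, y} : Finset A)) :
      z ∈ Submodule.span k (({1, x, y} : Finset A) : Set A) := Submodule.subset_span hz
  exact add_mem (add_mem (Submodule.smul_mem _ _ (hs (by simp)))
    (Submodule.smul_mem _ _ (hs (by simp)))) (Submodule.smul_mem _ _ (hs (by simp)))

/-- Since `ann y ⊆ ann x`, the map `y ↦ x` is defined on `Ay`; an extension to `A` would put `x = y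
* g 1` in `k·y`. -/
theorem not_baer (h : IsProductZeroPair k x y) : ¬ Module.Baer A A := by
  intro hA
  let φ := LinearMap.toSpanSingleton A A y
  have hle : LinearMap.ker φ ≤ LinearMap.ker (LinearMap.toSpanSingleton A A x) := by
    intro r hr
    have hr' : r * y = 0 := hr
    change r * x = 0
    obtain ⟨a, b, c, rfl⟩ := h.exists_eq r
    rw [h.mul_y] at hr'
    rw [h.mul_x, (smul_eq_zero.mp hr').resolve_right h.y_ne, zero_smul]
  obtain ⟨g, hg⟩ := hA.extension_property ((LinearMap.ker φ).liftQ φ le_rfl)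
    (LinearMap.ker_eq_bot.mp (Submodule.ker_liftQ_eq_bot _ _ _ le_rfl))
    ((LinearMap.ker φ).liftQ _ hle)
  have h1 : g (1 * y) = 1 * x := LinearMap.congr_fun hg ((LinearMap.ker φ).mkQ 1)
  have h2 : g y = y * g 1 := by rw [← smul_eq_mul y (g 1), ← map_smul, smul_eq_mul, mul_one]
  obtain ⟨a, b, c, hr⟩ := h.exists_eq (g 1)
  refine h.x_ne a ?_
  rw [one_mul, one_mul, h2, mul_comm, hr, h.mul_y] at h1
  exact h1.symm

theorem isCoatom_ker (h : IsProductZeroPair k x y) :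
    IsCoatom (LinearMap.ker (LinearMap.toSpanSingleton A A y)) := by
  refine Ideal.isMaximal_def.mp (Ideal.isMaximal_iff.mpr ⟨fun h1 => h.y_ne ?_, ?_⟩)
  · exact (one_mul y).symm.trans h1
  · intro J r hJ hr hrJ
    obtain ⟨a, b, c, rfl⟩ := h.exists_eq r
    have ha : a ≠ 0 := by
      rintro rfl
      exact hr ((h.mul_y 0 b c).trans (zero_smul _ _))
    have hn : b • x + c • y ∈ J := hJ (by
      change (b • x + c • y) * y = 0
      simpa using h.mul_y 0 b c)
    have : algebraMap k A a ∈ J := by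
      rw [add_assoc] at hrJ
      exact (Submodule.add_mem_iff_left J hn).mp hrJ
    have := J.mul_mem_left (algebraMap k A a⁻¹) this
    rwa [← map_mul, inv_mul_cancel₀ ha, map_one] at this

/-- The homomorphism `φ ↦ φ x` from the dual of `A` to the residue field of `A`. -/
noncomputable def evalX (h : IsProductZeroPair k x y) :
    DualModule k A →ₗ[A] A ⧸ LinearMap.ker (LinearMap.toSpanSingleton A A y) where
  toFun φ := Submodule.Quotient.mk (algebraMap k A (φ.toLin x))
  map_add' φ ψ := by rw [DualModule.add_toLin, map_add, Submodule.Quotient.mk_add]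
  map_smul' r φ := by
    rw [DualModule.smul_toLin, RingHom.id_apply, ← Submodule.Quotient.mk_smul,
      Submodule.Quotient.eq]
    obtain ⟨a, b, c, rfl⟩ := h.exists_eq r
    -- Only the constant term `a` of `r` matters: `rx = ax` and `ry = ay`.
    change (_ - _ * _) * y = 0
    rw [h.mul_x, map_smul, smul_eq_mul, map_mul, sub_mul,
      mul_right_comm (_ + _), h.mul_y, Algebra.smul_def]
    ring

/-- A functional `f` with `f y = 0` and `f x ≠ 0` is killed by `y`. So is its image under a lift,
which then has residue class `0` instead of `f x`. -/
theorem not_exists_lift (h : IsProductZeroPair k x y) :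
    ¬ ∃ g : DualModule k A →ₗ[A] A, (Submodule.mkQ _) ∘ₗ g = h.evalX := by
  rintro ⟨g, hg⟩
  obtain ⟨f, hf, hy⟩ := Submodule.exists_le_ker_of_notMem (p := Submodule.span k {y}) (v := x)
    (fun hx => by
      obtain ⟨c, hc⟩ := Submodule.mem_span_singleton.mp hx
      exact h.x_ne c hc.symm)
  have hfy : f y = 0 := hy (Submodule.mem_span_singleton_self y)
  let e : DualModule k A := f
  have hye : y • e = 0 := DualModule.ext fun r => by
    obtain ⟨a, b, c, rfl⟩ := h.exists_eq r
    change f (y * _) = 0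
    rw [mul_comm, h.mul_y, map_smul, hfy, smul_zero]
  have h1 : y * g e = 0 := by rw [← smul_eq_mul, ← map_smul, hye, map_zero]
  have h2 : Submodule.Quotient.mk (g e) = h.evalX e := LinearMap.congr_fun hg e
  have h3 : (g e - algebraMap k A (f x)) * y = 0 := (Submodule.Quotient.eq _).mp h2
  rw [sub_mul, mul_comm, h1, zero_sub, neg_eq_zero, ← Algebra.smul_def] at h3
  exact (smul_eq_zero.mp h3).elim hf h.y_ne

end IsProductZeroPair
end MaxQF

/-! ### Passage to right modules -/

namespace MaxQF

open MulOpposite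

section Opposite

variable {k : Type u} {A : Type v} [Field k] [CommRing A] [Algebra k A] {x y : A}

theorem IsSquareZeroPair.op (h : IsSquareZeroPair k x y) : IsSquareZeroPair k (op x) (op y) where
  x_mul_x := congrArg MulOpposite.op h.x_mul_x
  y_mul_y := congrArg MulOpposite.op h.y_mul_y
  x_mul_y_ne := by
    rw [mul_comm]
    exact fun h0 => h.x_mul_y_ne (op_injective h0)
  exists_eq r := by
    obtain ⟨a, b, c, d, hr⟩ := h.exists_eq r.unop
    refine ⟨a, b, c, d, unop_injective ?_⟩
    rw [hr, mul_comm x y]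
    rfl

theorem IsProductZeroPair.op (h : IsProductZeroPair k x y) :
    IsProductZeroPair k (op x) (op y) where
  x_mul_x := congrArg MulOpposite.op h.x_mul_x
  x_mul_y := by
    rw [mul_comm]
    exact congrArg MulOpposite.op h.x_mul_y
  y_mul_y := congrArg MulOpposite.op h.y_mul_y
  y_ne := fun h0 => h.y_ne (op_injective h0)
  x_ne c := fun h0 => h.x_ne c (op_injective h0)
  exists_eq r := by
    obtain ⟨a, b, c, hr⟩ := h.exists_eq r.unop
    exact ⟨a, b, c, unop_injective hr⟩

end Opposite

theorem IsRightAlmostQF.isRightMaxQF {R : Type u} [Ring R] (h : IsRightAlmostQF.{u, w} R) :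
    IsRightMaxQF.{u, w} R :=
  fun E _ _ hE I _ f => h E hE I f

theorem IsSquareZeroPair.isRightAlmostQF {k A : Type u} [Field k] [CommRing A] [Algebra k A]
    {x y : A} (h : IsSquareZeroPair k x y) : IsRightAlmostQF.{u, w} A := by
  intro E _ _ hE I f
  have : Small.{max u w} Aᵐᵒᵖ := small_max.{w} Aᵐᵒᵖ
  have := h.op.free_of_baer (Module.Baer.of_injective hE)
  exact Module.projective_lifting_property I.mkQ f I.mkQ_surjective

/-- The right regular module of `A` as the regular module of `Aᵐᵒᵖ`. -/
def rightRegularEquiv (A : Type u) [CommRing A] : Aᵐᵒᵖ ≃ₗ[Aᵐᵒᵖ] A :=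
  (opLinearEquiv Aᵐᵒᵖ (M := A)).symm

theorem isRightArtinian_of_finite (k : Type u) {A : Type v} [Field k] [CommRing A] [Algebra k A]
    [Module.Finite k A] : IsRightArtinian A := by
  have : Module.Finite k Aᵐᵒᵖ := Module.Finite.equiv (opLinearEquiv k)
  have : IsArtinian Aᵐᵒᵖ Aᵐᵒᵖ := isArtinian_of_tower k inferInstance
  exact isArtinian_of_linearEquiv (rightRegularEquiv A)

theorem isRightSelfInjective_iff {A : Type u} [CommRing A] :
    IsRightSelfInjective A ↔ Module.Baer Aᵐᵒᵖ Aᵐᵒᵖ :=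
  Module.Baer.iff_injective.symm.trans (Module.Baer.congr (rightRegularEquiv A)).symm

theorem IsSquareZeroPair.isQF {k A : Type u} [Field k] [CommRing A] [Algebra k A]
    {x y : A} (h : IsSquareZeroPair k x y) : IsQF A := by
  have := h.finite
  exact ⟨isRightSelfInjective_iff.mpr h.op.baer, isRightArtinian_of_finite k⟩

theorem IsProductZeroPair.not_isRightMaxQF {k A : Type u} [Field k] [CommRing A] [Algebra k A]
    {x y : A} (h : IsProductZeroPair k x y) : ¬ IsRightMaxQF.{u, w} A := by
  intro hA
  let e := rightRegularEquiv A
  let m := LinearMap.ker (LinearMap.toSpanSingleton Aᵐᵒᵖ Aᵐᵒᵖ (MulOpposite.op y))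
  let I : Submodule Aᵐᵒᵖ A := m.map (e : Aᵐᵒᵖ →ₗ[Aᵐᵒᵖ] A)
  have hI : IsCoatom I := ((Submodule.orderIsoMapComap e).isCoatom_iff m).mpr h.op.isCoatom_ker
  let q : (Aᵐᵒᵖ ⧸ m) ≃ₗ[Aᵐᵒᵖ] A ⧸ I := Submodule.Quotient.equiv m I e rfl
  -- The lift places the dual in the universe over which the injective test modules range.
  let d : ULift.{w} (DualModule k Aᵐᵒᵖ) ≃ₗ[Aᵐᵒᵖ] DualModule k Aᵐᵒᵖ := ULift.moduleEquiv
  have hinj : Module.Injective Aᵐᵒᵖ (ULift.{w} (DualModule k Aᵐᵒᵖ)) :=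
    (DualModule.baer.of_equiv d.symm).injective
  obtain ⟨g, hg⟩ := hA (ULift.{w} (DualModule k Aᵐᵒᵖ)) hinj I hI
    (q.toLinearMap ∘ₗ h.op.evalX ∘ₗ d.toLinearMap)
  refine h.op.not_exists_lift ⟨e.symm.toLinearMap ∘ₗ g ∘ₗ d.symm.toLinearMap, ?_⟩
  refine LinearMap.ext fun φ => q.injective ?_
  have h1 : Submodule.Quotient.mk (g (d.symm φ)) = q (h.op.evalX (d (d.symm φ))) :=
    LinearMap.congr_fun hg (d.symm φ)
  rw [d.apply_symm_apply] at h1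
  refine Eq.trans ?_ h1
  change Submodule.Quotient.mk (e (e.symm (g (d.symm φ)))) = _
  rw [e.apply_symm_apply]

theorem IsProductZeroPair.not_isRightSelfInjective {k A : Type u} [Field k] [CommRing A]
    [Algebra k A] {x y : A} (h : IsProductZeroPair k x y) : ¬ IsRightSelfInjective A :=
  fun hA => h.op.not_baer (isRightSelfInjective_iff.mp hA)

/-! ### The two polynomial quotients -/

section Polynomial

open MvPolynomial

variable (k : Type u) [Field k]

theorem idealSq_eq_span_monomial : idealSq k = Ideal.span ((fun s => monomial s (1 : k)) ''
    {Finsupp.single 0 2, Finsupp.single 1 2}) := by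
  rw [Set.image_pair, idealSq, X_pow_eq_monomial, X_pow_eq_monomial]

theorem idealSqMul_eq_span_monomial : idealSqMul k = Ideal.span ((fun s => monomial s (1 : k)) ''
    {Finsupp.single 0 2, Finsupp.single 0 1 + Finsupp.single 1 1, Finsupp.single 1 2}) := by
  rw [Set.image_insert_eq, Set.image_pair, idealSqMul, X_pow_eq_monomial, X_pow_eq_monomial,
    X, X, monomial_mul, one_mul]

theorem idealSq_le_idealSqMul : idealSq k ≤ idealSqMul k :=
  Ideal.span_mono (by simp [Set.insert_subset_iff])

/-- `k[x, y] / (x², y²)` modulo `(x², xy, y²)` is `k[x, y] / (x², xy, y²)`. -/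
noncomputable def ringSEquiv :
    RingS k ≃ₐ[k] (MvPolynomial (Fin 2) k ⧸ idealSqMul k) :=
  DoubleQuot.quotQuotEquivQuotOfLEₐ k (idealSq_le_idealSqMul k)

theorem ringSEquiv_mk (p : MvPolynomial (Fin 2) k) :
    ringSEquiv k (Ideal.Quotient.mk _ (Ideal.Quotient.mk _ p)) = Ideal.Quotient.mk _ p := rfl

theorem isSquareZeroPair_ringR :
    IsSquareZeroPair k (Ideal.Quotient.mk (idealSq k) (X 0)) (Ideal.Quotient.mk (idealSq k) (X 1))
    where
  x_mul_x := by
    rw [← map_mul, ← sq, Ideal.Quotient.eq_zero_iff_mem]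
    exact Ideal.subset_span (by simp)
  y_mul_y := by
    rw [← map_mul, ← sq, Ideal.Quotient.eq_zero_iff_mem]
    exact Ideal.subset_span (by simp)
  x_mul_y_ne := by
    rw [← map_mul, Ne, Ideal.Quotient.eq_zero_iff_mem, idealSq_eq_span_monomial,
      mem_ideal_span_monomial_image, X, X, monomial_mul, one_mul]
    intro h
    -- Membership in a monomial ideal is tested on exponents: neither `x²` nor `y²` divides `xy`.
    obtain ⟨s, hs, hle⟩ := h (Finsupp.single 0 1 + Finsupp.single 1 1) (by simp)
    rcases hs with rfl | rfl
    · simpa using hle 0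
    · simpa using hle 1
  exists_eq r := by
    obtain ⟨p, rfl⟩ := Ideal.Quotient.mk_surjective r
    set x := Ideal.Quotient.mk (idealSq k) (X 0) with hx
    set y := Ideal.Quotient.mk (idealSq k) (X 1) with hy
    have hxx : x * x = 0 := by
      rw [hx, ← map_mul, ← sq, Ideal.Quotient.eq_zero_iff_mem]
      exact Ideal.subset_span (by simp)
    have hyy : y * y = 0 := by
      rw [hy, ← map_mul, ← sq, Ideal.Quotient.eq_zero_iff_mem]
      exact Ideal.subset_span (by simp)
    induction p using MvPolynomial.induction_on with
    | C a => exact ⟨a, 0, 0, 0, by simp only [zero_smul, add_zero]; rfl⟩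
    | add p q hp hq =>
      obtain ⟨a, b, c, d, hp⟩ := hp
      obtain ⟨a', b', c', d', hq⟩ := hq
      refine ⟨a + a', b + b', c + c', d + d', ?_⟩
      rw [map_add, map_add, hp, hq]
      simp only [add_smul]
      ring
    | mul_X p i hp =>
      obtain ⟨a, b, c, d, hp⟩ := hp
      rw [map_mul, hp]
      fin_cases i
      · refine ⟨0, a, 0, c, ?_⟩
        change _ * x = _
        simp only [Algebra.smul_def, map_zero]
        linear_combination (algebraMap k (RingR k) b + algebraMap k (RingR k) d * y) * hxx
      · refine ⟨0, 0, a, b, ?_⟩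
        change _ * y = _
        simp only [Algebra.smul_def, map_zero]
        linear_combination (algebraMap k (RingR k) c + algebraMap k (RingR k) d * x) * hyy

theorem isProductZeroPair_ringS :
    IsProductZeroPair k (Ideal.Quotient.mk (idealI k) (Ideal.Quotient.mk (idealSq k) (X 0)))
      (Ideal.Quotient.mk (idealI k) (Ideal.Quotient.mk (idealSq k) (X 1))) where
  x_mul_x := by
    rw [← map_mul, (isSquareZeroPair_ringR k).x_mul_x, map_zero]
  y_mul_y := by
    rw [← map_mul, (isSquareZeroPair_ringR k).y_mul_y, map_zero]
  x_mul_y := by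
    rw [← map_mul, ← map_mul, Ideal.Quotient.eq_zero_iff_mem]
    exact Ideal.mem_map_of_mem _ (Ideal.subset_span (by simp))
  y_ne h := by
    have h1 := congrArg (ringSEquiv k) h
    rw [ringSEquiv_mk, map_zero, Ideal.Quotient.eq_zero_iff_mem, idealSqMul_eq_span_monomial,
      mem_ideal_span_monomial_image] at h1
    obtain ⟨s, hs, hle⟩ := h1 (Finsupp.single 1 1) (by simp [X])
    rcases hs with rfl | rfl | rfl
    · simpa using hle 0
    · simpa using hle 0
    · simpa using hle 1
  x_ne c h := by
    have h1 := congrArg (ringSEquiv k) h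
    rw [map_smul, ringSEquiv_mk, ringSEquiv_mk] at h1
    have h2 : X 0 - c • X 1 ∈ idealSqMul k := (Submodule.Quotient.eq _).mp h1
    rw [idealSqMul_eq_span_monomial, mem_ideal_span_monomial_image] at h2
    -- The monomial `x` occurs in `x - cy` whatever `c` is, and no generator divides it.
    obtain ⟨s, hs, hle⟩ := h2 (Finsupp.single 0 1) (by
      simp [coeff_X, Finsupp.single_eq_single_iff])
    rcases hs with rfl | rfl | rfl
    · simpa using hle 0
    · simpa using hle 1
    · simpa using hle 1
  exists_eq r := by
    obtain ⟨r, rfl⟩ := Ideal.Quotient.mk_surjective r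
    obtain ⟨a, b, c, d, rfl⟩ := (isSquareZeroPair_ringR k).exists_eq r
    refine ⟨a, b, c, ?_⟩
    have hxy : Ideal.Quotient.mk (idealI k) (Ideal.Quotient.mk (idealSq k) (X 0) *
        Ideal.Quotient.mk (idealSq k) (X 1)) = 0 := by
      rw [← map_mul, Ideal.Quotient.eq_zero_iff_mem]
      exact Ideal.mem_map_of_mem _ (Ideal.subset_span (by simp))
    have hs (c : k) (z : RingR k) : Ideal.Quotient.mk (idealI k) (c • z) =
      c • Ideal.Quotient.mk (idealI k) z := rfl
    rw [map_add, map_add, map_add, hs, hs, hs, hxy, smul_zero, add_zero]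
    rfl

end Polynomial

end MaxQF

theorem mainTheorem10 (k : Type u) [Field k] :
    (IsLocalRing (MaxQF.RingR k) ∧ MaxQF.IsQF (MaxQF.RingR k) ∧
      MaxQF.IsRightAlmostQF.{u, w} (MaxQF.RingR k) ∧
      MaxQF.IsRightMaxQF.{u, w} (MaxQF.RingR k)) ∧
    (Nonempty (MaxQF.RingS k ≃ₐ[k] (MvPolynomial (Fin 2) k ⧸ MaxQF.idealSqMul k)) ∧
      MaxQF.IsRightArtinian (MaxQF.RingS k) ∧
      ¬ MaxQF.IsRightSelfInjective (MaxQF.RingS k) ∧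
      ¬ MaxQF.IsQF (MaxQF.RingS k) ∧
      ¬ MaxQF.IsRightMaxQF.{u, w} (MaxQF.RingS k) ∧
      ¬ MaxQF.IsRightAlmostQF.{u, w} (MaxQF.RingS k)) ∧
    (¬ ∀ (A : Type u) [Ring A] (J : Ideal A) [J.IsTwoSided],
      MaxQF.IsRightMaxQF.{u, w} A → MaxQF.IsRightMaxQF.{u, w} (A ⧸ J)) ∧
    (¬ ∀ (A : Type u) [Ring A] (J : Ideal A) [J.IsTwoSided],
      MaxQF.IsRightAlmostQF.{u, w} A → MaxQF.IsRightAlmostQF.{u, w} (A ⧸ J)) := by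
  have hR := MaxQF.isSquareZeroPair_ringR k
  have hS := MaxQF.isProductZeroPair_ringS k
  have hRqf := hR.isRightAlmostQF.{u, w}
  have hSmax := hS.not_isRightMaxQF.{u, w}
  have hSqf : ¬ MaxQF.IsRightAlmostQF.{u, w} (MaxQF.RingS k) := fun h => hSmax h.isRightMaxQF
  have := hS.finite
  refine ⟨⟨?_, ?_, ?_, ?_⟩, ⟨?_, ?_, ?_, ?_, ?_, ?_⟩, ?_, ?_⟩
  · exact hR.isLocalRing
  · exact hR.isQF
  · exact hRqf
  · exact hRqf.isRightMaxQF
  · exact ⟨MaxQF.ringSEquiv k⟩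
  · exact MaxQF.isRightArtinian_of_finite k (A := MaxQF.RingS k)
  · exact hS.not_isRightSelfInjective
  · exact fun h => hS.not_isRightSelfInjective h.1
  · exact hSmax
  · exact hSqf
  · exact fun h => hSmax (h (MaxQF.RingR k) (MaxQF.idealI k) hRqf.isRightMaxQF)
  · exact fun h => hSqf (h (MaxQF.RingR k) (MaxQF.idealI k) hRqf)
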